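/- Let $G$ be a group generated by a finite nonempty symmetric set $S=S^{-1}$, and let $H\le G$ be an arbitrary subgroup. For a group $K$ with a finite nonempty symmetric generating set $F$, let $\rho(K,F)$ be the spectral radius of the Cayley graph of $K$ with respect to $F$, that is, the operator norm on $\ell^2(K)$ of the Markov averaging operator $Pf(x)=\frac1{|F|}\sum_{s\in F}f(xs)$. Let $\rho(H\backslash G,S)$ be the spectral radius of the Schreier graph, that is, the operator norm on $\ell^2(H\backslash G)$ of $Pf(Hg)=\frac1{|S|}\sum_{s\in S}f(Hgs)$. For $g\in G$ put $H^g=g^{-1}Hg$, and write $\rho(H^g,S\cap H^g)$ for $\rho(\langle S\cap H^g\rangle,S\cap H^g)$, also when $S\cap H^g$ does not generate $H^g$. For $n\ge 1$ let $A(n,S)$ be the set of words $w=(a_1,\dots,a_n)\in S^n$ with $a_1a_2\cdots a_n=1$, write $w(i)=a_1a_2\cdots a_i$, and, if $A(n,S)\neq\emptyset$ (which holds for every even $n$), let $$\mu_n=\frac1{|A(n,S)|}\sum_{w\in A(n,S)}\Bigl(\frac1n\sum_{i=1}^n\delta_{w(i)}\Bigr),$$ the averaged occupation measure of closed walks of length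 $n$ based at the identity. Put $$I(H,S)=\limsup_{n\to\infty}\int |H^g\cap S|\,\bigl(-\log\rho(H^g,S\cap H^g)\bigr)\,d\mu_{2n}(g),$$ where the integrand is $0$ if $H^g\cap S=\emptyset$. Then $$\log\rho(H\backslash G,S)-\log\rho(G,S)\ \ge\ \frac{I(H,S)}{|S|^2\,\rho(G,S)^2}.$$ -/

import Mathlib

open MeasureTheory Filter
open scoped ENNReal

noncomputable section

namespace Kesten

/-- The Hilbert space of square-summable real functions on a vertex set `X`. -/
abbrev ell2 (X : Type*) : Type _ := lp (fun _ : X => ℝ) 2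

theorem memℓp_comp_perm {X : Type*} (σ : Equiv.Perm X) (f : ell2 X) :
    Memℓp (fun x => f (σ x)) 2 := by
  refine memℓp_gen ?_
  have h := (lp.memℓp f).summable (by norm_num)
  exact h.comp_injective σ.injective

/-- The isometry `f ↦ f ∘ σ` of `ℓ²(X)` defined by a permutation `σ` of `X`. -/
def permIsometry {X : Type*} (σ : Equiv.Perm X) : ell2 X →ₗᵢ[ℝ] ell2 X where
  toFun f := ⟨fun x => f (σ x), memℓp_comp_perm σ f⟩
  map_add' f g := rfl
  map_smul' c f := rfl
  norm_map' f := by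
    rw [lp.norm_eq_tsum_rpow (by norm_num), lp.norm_eq_tsum_rpow (by norm_num)]
    congr 1
    exact Equiv.tsum_eq σ (fun x => ‖f x‖ ^ (2 : ℝ≥0∞).toReal)

/-- The Markov averaging operator `P f (x) = |ι|⁻¹ ∑ i, f (π i x)` on `ℓ²(X)` of the regular
multigraph with vertex set `X` in which each vertex `x` is joined to the vertices `π i x`, `i : ι`
(loops and multiple edges are allowed, so that every vertex has degree `|ι|`). -/
def markovOp {X ι : Type*} [Fintype ι] (π : ι → Equiv.Perm X) : ell2 X →L[ℝ] ell2 X :=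
  (Fintype.card ι : ℝ)⁻¹ • ∑ i, (permIsometry (π i)).toContinuousLinearMap

/-- The formula for the averaging operator. -/
theorem markovOp_apply {X ι : Type*} [Fintype ι] (π : ι → Equiv.Perm X) (f : ell2 X) (x : X) :
    markovOp π f x = (Fintype.card ι : ℝ)⁻¹ * ∑ i, f (π i x) := by
  simp only [markovOp, smul_apply, sum_apply,
    lp.coeFn_smul, lp.coeFn_sum]
  exact congrArg ((Fintype.card ι : ℝ)⁻¹ * ·) (Finset.sum_apply x _ _)

/-- The spectral radius of the multigraph above: the operator norm of its averaging operator. -/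
def graphRho {X ι : Type*} [Fintype ι] (π : ι → Equiv.Perm X) : ℝ := ‖markovOp π‖

/-- The coset space `H\G`, whose points are the cosets `Hg`. -/
abbrev Cosets {G : Type*} [Group G] (H : Subgroup G) : Type _ :=
  Quotient (QuotientGroup.rightRel H)

/-- The permutation `Hg ↦ Hgs` of `H\G`. -/
def cosetPerm {G : Type*} [Group G] (H : Subgroup G) (s : G) : Equiv.Perm (Cosets H) :=
  Quotient.congr (Equiv.mulRight s) fun a b => by
    simp [QuotientGroup.rightRel_apply, mul_assoc]

/-- `ρ(H\G, S)`: the spectral radius of the Schreier graph `Sch(H\G, S)`, in which `Hg` is joined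
to `Hgs` for `s ∈ S`. -/
def schreierRho {G : Type*} [Group G] (H : Subgroup G) (S : Finset G) : ℝ :=
  graphRho fun s : S => cosetPerm H (s : G)

/-- `ρ(G, S)`: the spectral radius of the Cayley graph `Cay(G, S)`, in which `g` is joined to `gs`
for `s ∈ S`. -/
def cayleyRho {G : Type*} [Group G] (S : Finset G) : ℝ :=
  graphRho fun s : S => Equiv.mulRight (s : G)

open scoped Classical in
/-- `ρ(⟨F⟩, F)`: the spectral radius of the Cayley graph, with respect to `F`, of the subgroup
generated by `F`. -/
def spanRho {G : Type*} [Group G] (F : Finset G) : ℝ :=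
  cayleyRho (F.subtype (· ∈ Subgroup.closure (F : Set G)))

/-- The conjugate subgroup `H^g = g⁻¹Hg`. -/
def conjSubgroup {G : Type*} [Group G] (H : Subgroup G) (g : G) : Subgroup G :=
  H.map (MulAut.conj g⁻¹).toMonoidHom

open scoped Classical in
/-- The finite set `H^g ∩ S`. -/
def conjInter {G : Type*} [Group G] (H : Subgroup G) (S : Finset G) (g : G) : Finset G :=
  S.filter (· ∈ conjSubgroup H g)

open scoped Classical in
/-- `A(n, S)`: the words `w = (a₁, …, aₙ) ∈ Sⁿ` with `a₁ ⋯ aₙ = 1`, that is, the walks of length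
`n` on `Cay(G, S)` that start at the identity and return to it at time `n`. Here
`Fin.partialProd w i = a₁ ⋯ aᵢ` is the position `w(i)` after `i` steps. -/
def closedWalks {G : Type*} [Group G] (S : Finset G) (n : ℕ) : Finset (Fin n → G) :=
  (Fintype.piFinset fun _ => S).filter fun w => Fin.partialProd w (Fin.last n) = 1

/-- The averaged occupation measure
`μₙ = |A(n, S)|⁻¹ ∑_{w ∈ A(n, S)} (n⁻¹ ∑_{i = 1}^{n} δ_{w(i)})` on the discrete space `G`. -/
def occMeasure {G : Type*} [Group G] (S : Finset G) (n : ℕ) : @Measure G ⊤ :=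
  letI : MeasurableSpace G := ⊤
  ((closedWalks S n).card : ℝ≥0∞)⁻¹ • ∑ w ∈ closedWalks S n,
    ((n : ℝ≥0∞)⁻¹ • ∑ i : Fin n, Measure.dirac (Fin.partialProd w i.succ))

/-- `I(H, S) = limsup_{n → ∞} ∫ |H^g ∩ S| (-log ρ(H^g, S ∩ H^g)) dμ_{2n}(g)`, where
`ρ(H^g, S ∩ H^g)` means `ρ(⟨S ∩ H^g⟩, S ∩ H^g)` if `S ∩ H^g` does not generate `H^g`. -/
def kestenI {G : Type*} [Group G] (H : Subgroup G) (S : Finset G) : ℝ :=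
  limsup (fun n : ℕ => ∫ g, ((conjInter H S g).card : ℝ) * -Real.log (spanRho (conjInter H S g))
    ∂(occMeasure S (2 * n))) atTop

end Kesten

end

/-! ### Square-summable functions and sums of right translations -/

noncomputable section

namespace Kesten

/-! Call a step from `g` to `gs` with `Hgs = Hg` a loop, and give it the weight `1/ρ`, where `ρ =
ρ(H^g, S ∩ H^g)`; other steps have weight `1`. With `F = S ∩ H^g`, the loops at `g` act on `ℓ²(G)`
as a sum of right translations of norm at most `|F| ρ` (`norm_sum_translate_le`), so the weight is
exactly absorbed. Hence weighted walks on `G` are controlled by unweighted walks on `H\G`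
(`norm_weightVec_le`), and the sum of `exp (cost)` over `A(n, S)` is at most `|S|ⁿ ρ(H\G, S)ⁿ`
(`sum_exp_walkCost_le`).

Jensen's inequality replaces this sum by `|A(n, S)| exp (mean cost)`. The mean cost is bounded below
by inserting a loop `s` followed by `s⁻¹` at any time of a closed walk shorter by two
(`walkSum_sum_le_walkSum_walkCost`). Since `|A(2n+2, S)| ≤ |S|² ρ(G, S)² |A(2n, S)|`, the passage
between the two lengths produces the denominator `|S|² ρ(G, S)²`.

Finally `|A(2n, S)|` is at least a constant times `(|S| a)^(2n)` for every `a < ρ(G, S)`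
(`exists_le_norm_cayleyOp_pow`). Taking logarithms, dividing by `2n` and letting `a` tend to `ρ(G,
S)` gives the theorem. -/

theorem summable_sq {X : Type*} (f : ell2 X) : Summable fun x => f x ^ 2 := by
  have h := (lp.memℓp f).summable (by norm_num)
  simpa using h

theorem norm_sq_eq_tsum {X : Type*} (f : ell2 X) : ‖f‖ ^ 2 = ∑' x, f x ^ 2 := by
  have h := lp.norm_rpow_eq_tsum (p := 2) (by norm_num) f
  simpa using h

/-- The restriction of a square-summable function along an injection. -/
def pullback {X Y : Type*} (j : Y → X) (hj : Function.Injective j) (f : ell2 X) : ell2 Y :=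
  ⟨fun y => f (j y), memℓp_gen (((lp.memℓp f).summable (by norm_num)).comp_injective hj)⟩

theorem pullback_apply {X Y : Type*} (j : Y → X) (hj : Function.Injective j) (f : ell2 X) (y : Y) :
    pullback j hj f y = f (j y) := rfl

theorem permIsometry_apply {X : Type*} (σ : Equiv.Perm X) (f : ell2 X) (x : X) :
    permIsometry σ f x = f (σ x) := rfl

theorem graphRho_nonneg {X ι : Type*} [Fintype ι] (π : ι → Equiv.Perm X) : 0 ≤ graphRho π :=
  norm_nonneg _

theorem graphRho_le_one {X ι : Type*} [Fintype ι] (π : ι → Equiv.Perm X) : graphRho π ≤ 1 := by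
  refine ContinuousLinearMap.opNorm_le_bound _ zero_le_one fun f => ?_
  have h : ‖∑ i, permIsometry (π i) f‖ ≤ Fintype.card ι * ‖f‖ := by
    refine (norm_sum_le _ _).trans ?_
    simp
  have e : markovOp π f = (Fintype.card ι : ℝ)⁻¹ • ∑ i, permIsometry (π i) f := by
    simp [markovOp]
  rw [e, norm_smul, norm_inv, Real.norm_natCast]
  calc (Fintype.card ι : ℝ)⁻¹ * ‖∑ i, permIsometry (π i) f‖
      ≤ (Fintype.card ι : ℝ)⁻¹ * (Fintype.card ι * ‖f‖) := by gcongr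
    _ = ((Fintype.card ι : ℝ)⁻¹ * Fintype.card ι) * ‖f‖ := by ring
    _ ≤ 1 * ‖f‖ := by gcongr; exact inv_mul_le_one

theorem graphRho_of_isEmpty {X ι : Type*} [Fintype ι] [IsEmpty ι] (π : ι → Equiv.Perm X) :
    graphRho π = 0 := by
  simp [graphRho, markovOp]

theorem spanRho_nonneg {G : Type*} [Group G] (F : Finset G) : 0 ≤ spanRho F := graphRho_nonneg _

theorem spanRho_le_one {G : Type*} [Group G] (F : Finset G) : spanRho F ≤ 1 := graphRho_le_one _

/-- The sum of the right translations by `F` has norm at most `|F| ρ(⟨F⟩, F)` on `ℓ²(G)`. -/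
theorem norm_sum_translate_le {G : Type*} [Group G] (F : Finset G) (f : ell2 G) :
    ‖∑ s ∈ F, permIsometry (Equiv.mulRight s) f‖ ≤ F.card * spanRho F * ‖f‖ := by
  classical
  set K := Subgroup.closure (F : Set G) with hK
  set Q := ∑ s ∈ F, permIsometry (Equiv.mulRight s) f with hQ
  have hQx (x : G) : Q x = ∑ s ∈ F, f (x * s) := by
    simp only [hQ, lp.coeFn_sum, Finset.sum_apply, permIsometry_apply, Equiv.coe_mulRight]
  -- Right translation by `F` preserves each left coset `tK`, so `ℓ²(G)` splits orthogonally into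
  -- copies of `ℓ²(K)`, on each of which the sum acts as `|F|` times the averaging operator of
  -- `Cay(K, F)`.
  let j (t : G ⧸ K) (k : K) : G := t.out * k
  have hj (t : G ⧸ K) : Function.Injective (j t) := fun a b h =>
    Subtype.ext (mul_left_cancel h)
  have hbij : Function.Bijective fun p : (G ⧸ K) × K => j p.1 p.2 := by
    constructor
    · rintro ⟨t, k⟩ ⟨t', k'⟩ h
      have ht : t = t' := by
        have h' := congrArg (QuotientGroup.mk (s := K)) h
        simpa only [j, QuotientGroup.mk_mul_of_mem _ (Subtype.prop _),
          QuotientGroup.out_eq'] using h'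
      subst ht
      exact Prod.ext rfl (hj t h)
    · intro x
      have hx : (QuotientGroup.mk x : G ⧸ K).out⁻¹ * x ∈ K :=
        QuotientGroup.eq.1 (QuotientGroup.out_eq' _)
      exact ⟨(QuotientGroup.mk x, ⟨_, hx⟩), by simp [j]⟩
  have hdecomp (g : ell2 G) : (Summable fun t => ‖pullback (j t) (hj t) g‖ ^ 2) ∧
      ‖g‖ ^ 2 = ∑' t, ‖pullback (j t) (hj t) g‖ ^ 2 := by
    have hs : Summable fun p : (G ⧸ K) × K => g (j p.1 p.2) ^ 2 :=
      (summable_sq g).comp_injective hbij.injective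
    have hn (t : G ⧸ K) : ‖pullback (j t) (hj t) g‖ ^ 2 = ∑' k, g (j t k) ^ 2 :=
      norm_sq_eq_tsum _
    simp only [hn]
    refine ⟨hs.prod, ?_⟩
    rw [norm_sq_eq_tsum, ← hs.tsum_prod]
    exact ((Equiv.ofBijective _ hbij).tsum_eq fun x => g x ^ 2).symm
  have hcard : (Fintype.card (F.subtype (· ∈ K)) : ℝ) = F.card := by
    rw [Fintype.card_coe, Finset.card_subtype, Finset.filter_true_of_mem]
    exact fun s hs => Subgroup.subset_closure hs
  have hpull (t : G ⧸ K) : ‖pullback (j t) (hj t) Q‖ ≤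
      F.card * spanRho F * ‖pullback (j t) (hj t) f‖ := by
    have : pullback (j t) (hj t) Q = (F.card : ℝ) •
        markovOp (fun s : F.subtype (· ∈ K) => Equiv.mulRight (s : K)) (pullback (j t) (hj t) f) := by
      ext k
      rw [lp.coeFn_smul, Pi.smul_apply, markovOp_apply, hcard, pullback_apply, hQx, smul_eq_mul]
      simp only [pullback_apply, Equiv.coe_mulRight]
      have hsum : ∑ i : F.subtype (· ∈ K), f (j t (k * i)) = ∑ s ∈ F, f (j t k * s) := by
        refine (Finset.sum_coe_sort (F.subtype (· ∈ K)) (fun s : K => f (j t (k * s)))).trans ?_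
        rw [← Finset.sum_subtype_of_mem (p := (· ∈ K)) (fun s => f (j t k * s))
          (fun s hs => Subgroup.subset_closure hs)]
        simp [j, mul_assoc]
      rw [hsum]
      rcases F.eq_empty_or_nonempty with h | h
      · simp [h]
      · rw [mul_inv_cancel_left₀ (by exact_mod_cast h.card_pos.ne')]
    rw [this, norm_smul, Real.norm_natCast, mul_assoc]
    gcongr
    exact ContinuousLinearMap.le_opNorm _ _
  have hc : 0 ≤ (F.card : ℝ) * spanRho F := mul_nonneg (Nat.cast_nonneg _) (spanRho_nonneg F)
  refine le_of_sq_le_sq ?_ (mul_nonneg hc (norm_nonneg f))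
  rw [mul_pow, (hdecomp Q).2, (hdecomp f).2, ← tsum_mul_left]
  refine (hdecomp Q).1.tsum_le_tsum (fun t => ?_) ((hdecomp f).1.mul_left _)
  rw [← mul_pow]
  exact pow_le_pow_left₀ (norm_nonneg _) (hpull t) 2

/-! ### Symmetric operators and unit masses -/

open scoped RealInnerProductSpace

theorem inner_permIsometry {X : Type*} (σ : Equiv.Perm X) (f g : ell2 X) :
    ⟪permIsometry σ f, g⟫ = ⟪f, permIsometry σ⁻¹ g⟫ := by
  rw [lp.inner_eq_tsum, lp.inner_eq_tsum, ← Equiv.tsum_eq σ (fun x => ⟪f x, permIsometry σ⁻¹ g x⟫)]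
  simp [permIsometry_apply]

/-- The averaging operator of a family of permutations closed under inversion is symmetric. -/
theorem inner_markovOp {X ι : Type*} [Fintype ι] (π : ι → Equiv.Perm X) (inv : Equiv.Perm ι)
    (hinv : ∀ i, π (inv i) = (π i)⁻¹) (f g : ell2 X) :
    ⟪markovOp π f, g⟫ = ⟪f, markovOp π g⟫ := by
  have e (f : ell2 X) : markovOp π f = (Fintype.card ι : ℝ)⁻¹ • ∑ i, permIsometry (π i) f := by
    simp [markovOp]
  rw [e, e, real_inner_smul_left, real_inner_smul_right, sum_inner, inner_sum,
    ← Equiv.sum_comp inv (fun i => ⟪f, permIsometry (π i) g⟫)]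
  simp only [inner_permIsometry, hinv]

/-- For a symmetric operator, the growth of `‖Tⁿ f‖` is at least that of the first step. -/
theorem pow_mul_norm_le_norm_pow {E : Type*} [NormedAddCommGroup E] [InnerProductSpace ℝ E]
    (T : E →L[ℝ] E) (hT : ∀ f g, ⟪T f, g⟫ = ⟪f, T g⟫) (f : E) {a : ℝ} (ha : 0 < a)
    (h : a * ‖f‖ ≤ ‖T f‖) (n : ℕ) :
    a ^ n * ‖f‖ ≤ ‖(T ^ n) f‖ ∧ a * ‖(T ^ n) f‖ ≤ ‖(T ^ (n + 1)) f‖ := by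
  induction n with
  | zero => simpa using h
  | succ n ih =>
    have h1 : a ^ (n + 1) * ‖f‖ ≤ ‖(T ^ (n + 1)) f‖ := by
      refine le_trans ?_ ih.2
      rw [pow_succ', mul_assoc]
      exact mul_le_mul_of_nonneg_left ih.1 ha.le
    refine ⟨h1, ?_⟩
    -- Symmetry and Cauchy–Schwarz make `‖Tⁿ f‖` log-convex in `n`, so the growth ratio never drops.
    have key : ‖(T ^ (n + 1)) f‖ ^ 2 ≤ ‖(T ^ n) f‖ * ‖(T ^ (n + 2)) f‖ := by
      have e1 : (T ^ (n + 1)) f = T ((T ^ n) f) := by rw [pow_succ']; rfl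
      have e2 : (T ^ (n + 2)) f = T ((T ^ (n + 1)) f) := by rw [pow_succ' T (n + 1)]; rfl
      rw [← real_inner_self_eq_norm_sq]
      nth_rewrite 1 [e1]
      rw [hT, ← e2]
      exact real_inner_le_norm _ _
    rcases (norm_nonneg ((T ^ (n + 1)) f)).eq_or_lt with h0 | h0
    · rw [← h0, mul_zero]; exact norm_nonneg _
    · refine le_of_mul_le_mul_right ?_ h0
      nlinarith [norm_nonneg ((T ^ (n + 2)) f), norm_nonneg ((T ^ n) f)]

/-- The unit mass at a vertex. -/
def unitMass {X : Type*} (x : X) : ell2 X :=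
  open scoped Classical in lp.single 2 x 1

open scoped Classical in
theorem unitMass_apply {X : Type*} (x y : X) : unitMass x y = if y = x then 1 else 0 := by
  by_cases h : y = x
  · subst h; simp [unitMass]
  · simp [unitMass, h]

theorem norm_unitMass {X : Type*} (x : X) : ‖unitMass x‖ = 1 := by
  classical
  simp [unitMass, lp.norm_single]

theorem inner_unitMass {X : Type*} (f : ell2 X) (x : X) : ⟪f, unitMass x⟫ = f x := by
  classical
  rw [lp.inner_eq_tsum, tsum_eq_single x]
  · simp [unitMass_apply]
  · intro y hy
    simp [unitMass_apply, hy]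

/-! ### Lower bound for return probabilities on the Cayley graph -/

section Cayley

variable {G : Type*} [Group G] (S : Finset G)

/-- The averaging operator of the Cayley graph. -/
abbrev cayleyOp : ell2 G →L[ℝ] ell2 G := markovOp fun s : S => Equiv.mulRight (s : G)

theorem inner_cayleyOp (hsymm : ∀ s ∈ S, s⁻¹ ∈ S) (f g : ell2 G) :
    ⟪cayleyOp S f, g⟫ = ⟪f, cayleyOp S g⟫ := by
  let inv : Equiv.Perm S :=
    { toFun s := ⟨s⁻¹, hsymm s s.2⟩
      invFun s := ⟨s⁻¹, hsymm s s.2⟩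
      left_inv s := by simp
      right_inv s := by simp }
  exact inner_markovOp _ inv (fun s => by ext x; simp [inv]) f g

theorem inner_cayleyOp_pow (hsymm : ∀ s ∈ S, s⁻¹ ∈ S) (n : ℕ) (f g : ell2 G) :
    ⟪(cayleyOp S ^ n) f, g⟫ = ⟪f, (cayleyOp S ^ n) g⟫ := by
  induction n generalizing f with
  | zero => simp
  | succ n ih =>
    rw [pow_succ]
    nth_rewrite 2 [← pow_succ]
    rw [pow_succ']
    exact (ih (cayleyOp S f)).trans (inner_cayleyOp S hsymm f _)

/-- Left translations are isometries that commute with the averaging operator. -/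
theorem norm_cayleyOp_pow_unitMass (n : ℕ) (x : G) :
    ‖(cayleyOp S ^ n) (unitMass x)‖ = ‖(cayleyOp S ^ n) (unitMass (1 : G))‖ := by
  set L := permIsometry (Equiv.mulLeft x⁻¹) with hL
  have hcomm (f : ell2 G) : cayleyOp S (L f) = L (cayleyOp S f) := by
    ext y
    rw [markovOp_apply, hL, permIsometry_apply, markovOp_apply]
    simp [permIsometry_apply, mul_assoc]
  have hpow (f : ell2 G) : (cayleyOp S ^ n) (L f) = L ((cayleyOp S ^ n) f) := by
    induction n generalizing f with
    | zero => rfl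
    | succ n ih =>
      rw [pow_succ]
      exact (congrArg _ (hcomm f)).trans (ih _)
  have h1 : unitMass x = L (unitMass 1) := by
    ext y
    rw [hL, permIsometry_apply, unitMass_apply, unitMass_apply]
    classical
    exact if_congr (by rw [Equiv.coe_mulLeft, inv_mul_eq_one, eq_comm]) rfl rfl
  rw [h1, hpow, L.norm_map]

/-- Return probabilities decay no faster than any exponential below the spectral radius. -/
theorem exists_le_norm_cayleyOp_pow (hsymm : ∀ s ∈ S, s⁻¹ ∈ S) {a : ℝ} (ha : 0 < a)
    (haS : a < cayleyRho S) :
    ∃ c : ℝ, 0 < c ∧ ∀ n, c * a ^ n ≤ ‖(cayleyOp S ^ n) (unitMass (1 : G))‖ := by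
  classical
  -- Finitely supported functions are dense, so one of them already witnesses that the norm exceeds
  -- `a`. Its iterates are then compared with those of a single unit mass.
  obtain ⟨F, f, hf⟩ : ∃ (F : Finset G) (f : G → ℝ),
      a * ‖∑ x ∈ F, f x • unitMass x‖ < ‖cayleyOp S (∑ x ∈ F, f x • unitMass x)‖ := by
    by_contra! hcon
    refine haS.not_ge (ContinuousLinearMap.opNorm_le_bound _ ha.le fun f => ?_)
    have hsum : HasSum (fun x => f x • unitMass x) f := by
      have := lp.hasSum_single (p := 2) (by norm_num) f
      convert this using 2 with x
      ext y
      by_cases h : y = x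
      · subst h; simp [unitMass]
      · simp [unitMass, h]
    exact le_of_tendsto_of_tendsto' (((cayleyOp S).continuous.tendsto f).comp hsum).norm
      (hsum.norm.const_mul a) (fun F => hcon F f)
  set v := ∑ x ∈ F, f x • unitMass x with hv
  have hv0 : 0 < ‖v‖ := by
    rw [norm_pos_iff]
    intro h
    simp [h] at hf
  set C := ∑ x ∈ F, |f x| with hC
  have hbound (n : ℕ) : ‖(cayleyOp S ^ n) v‖ ≤ C * ‖(cayleyOp S ^ n) (unitMass (1 : G))‖ := by
    rw [hv, map_sum, hC, Finset.sum_mul]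
    refine norm_sum_le_of_le _ fun x _ => ?_
    rw [map_smul, norm_smul, Real.norm_eq_abs, norm_cayleyOp_pow_unitMass]
  have hlow (n : ℕ) := (pow_mul_norm_le_norm_pow (cayleyOp S) (inner_cayleyOp S hsymm) v ha hf.le n).1
  have hC0 : 0 < C := by
    have h := (hlow 0).trans (hbound 0)
    simp only [pow_zero, one_mul, one_apply_eq_self, norm_unitMass, mul_one] at h
    exact hv0.trans_le h
  refine ⟨‖v‖ / C, by positivity, fun n => ?_⟩
  rw [div_mul_eq_mul_div, div_le_iff₀ hC0]
  linarith [hlow n, hbound n]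

end Cayley

/-! ### Counting walks that end at the identity -/

section Walks

theorem sum_piFinset_succ {α M : Type*} [AddCommMonoid M] (S : Finset α) (n : ℕ)
    (φ : (Fin (n + 1) → α) → M) :
    ∑ w ∈ Fintype.piFinset (fun _ : Fin (n + 1) => S), φ w =
      ∑ s ∈ S, ∑ w ∈ Fintype.piFinset (fun _ : Fin n => S), φ (Fin.cons s w) := by
  rw [← Finset.sum_product']
  refine Finset.sum_bij' (fun w _ => (w 0, Fin.tail w)) (fun p _ => Fin.cons p.1 p.2) ?_ ?_ ?_ ?_ ?_
  · intro w hw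
    rw [Fintype.mem_piFinset] at hw
    exact Finset.mem_product.2 ⟨hw 0, Fintype.mem_piFinset.2 fun i => hw i.succ⟩
  · intro p hp
    obtain ⟨h0, h1⟩ := Finset.mem_product.1 hp
    rw [Fintype.mem_piFinset] at h1 ⊢
    exact Fin.cases h0 h1
  · intro w _; exact Fin.cons_self_tail w
  · intro p _; rfl
  · intro w _; simp

variable {G : Type*} [Group G]

theorem partialProd_cons_succ {n : ℕ} (s : G) (w : Fin n → G) (i : Fin (n + 1)) :
    Fin.partialProd (Fin.cons s w : Fin (n + 1) → G) i.succ = s * Fin.partialProd w i := by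
  rw [Fin.partialProd_succ']; rfl

open scoped Classical in
/-- The sum of `φ` over the walks of length `n` from `x` to the identity. -/
def walkSum (S : Finset G) (n : ℕ) (x : G) (φ : (Fin n → G) → ℝ) : ℝ :=
  ∑ w ∈ Fintype.piFinset (fun _ : Fin n => S),
    if x * Fin.partialProd w (Fin.last n) = 1 then φ w else 0

theorem walkSum_succ (S : Finset G) (n : ℕ) (x : G) (φ : (Fin (n + 1) → G) → ℝ) :
    walkSum S (n + 1) x φ = ∑ s ∈ S, walkSum S n (x * s) fun w => φ (Fin.cons s w) := by
  simp only [walkSum]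
  rw [sum_piFinset_succ]
  classical
  refine Finset.sum_congr rfl fun s _ => Finset.sum_congr rfl fun w _ => if_congr ?_ rfl rfl
  rw [← Fin.succ_last, partialProd_cons_succ, mul_assoc]

open scoped Classical in
theorem walkSum_zero (S : Finset G) (x : G) (φ : (Fin 0 → G) → ℝ) :
    walkSum S 0 x φ = if x = 1 then φ Fin.elim0 else 0 := by
  simp [walkSum, Fintype.piFinset_of_isEmpty, Subsingleton.elim default Fin.elim0]

theorem walkSum_one_eq (S : Finset G) (n : ℕ) (φ : (Fin n → G) → ℝ) :
    walkSum S n 1 φ = ∑ w ∈ closedWalks S n, φ w := by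
  rw [walkSum, closedWalks, Finset.sum_filter]
  classical
  exact Finset.sum_congr rfl fun w _ => if_congr (by rw [one_mul]) rfl rfl

theorem walkSum_add (S : Finset G) (n : ℕ) (x : G) (φ ψ : (Fin n → G) → ℝ) :
    walkSum S n x (fun w => φ w + ψ w) = walkSum S n x φ + walkSum S n x ψ := by
  simp only [walkSum, ← Finset.sum_add_distrib]
  exact Finset.sum_congr rfl fun w _ => by split_ifs <;> simp

theorem walkSum_mul_left (S : Finset G) (n : ℕ) (x : G) (c : ℝ) (φ : (Fin n → G) → ℝ) :
    walkSum S n x (fun w => c * φ w) = c * walkSum S n x φ := by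
  simp only [walkSum, Finset.mul_sum, mul_ite, mul_zero]

theorem walkSum_nonneg (S : Finset G) (n : ℕ) (x : G) {φ : (Fin n → G) → ℝ} (h : ∀ w, 0 ≤ φ w) :
    0 ≤ walkSum S n x φ :=
  Finset.sum_nonneg fun w _ => by split_ifs; exacts [h w, le_rfl]

/-- The number of walks of length `n` from `x` to the identity. -/
def walkCount (S : Finset G) (n : ℕ) (x : G) : ℝ := walkSum S n x fun _ => 1

theorem walkSum_const (S : Finset G) (n : ℕ) (x : G) (c : ℝ) :
    walkSum S n x (fun _ => c) = c * walkCount S n x := by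
  rw [walkCount, ← walkSum_mul_left]; simp

theorem walkCount_nonneg (S : Finset G) (n : ℕ) (x : G) : 0 ≤ walkCount S n x :=
  walkSum_nonneg S n x fun _ => zero_le_one

theorem walkCount_succ (S : Finset G) (n : ℕ) (x : G) :
    walkCount S (n + 1) x = ∑ s ∈ S, walkCount S n (x * s) := walkSum_succ S n x _

theorem walkCount_one_eq (S : Finset G) (n : ℕ) :
    walkCount S n 1 = (closedWalks S n).card := by
  rw [walkCount, walkSum_one_eq]; simp

theorem walkCount_eq (S : Finset G) (hS : S.Nonempty) (n : ℕ) (x : G) :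
    walkCount S n x = (S.card : ℝ) ^ n * (cayleyOp S ^ n) (unitMass (1 : G)) x := by
  have hS0 : (S.card : ℝ) ≠ 0 := by exact_mod_cast hS.card_pos.ne'
  induction n generalizing x with
  | zero =>
    classical
    rw [walkCount, walkSum_zero]
    simp [unitMass_apply]
  | succ n ih =>
    have e : (cayleyOp S ^ (n + 1)) (unitMass (1 : G)) =
        cayleyOp S ((cayleyOp S ^ n) (unitMass (1 : G))) := by rw [pow_succ']; rfl
    rw [walkCount_succ, e, markovOp_apply, Fintype.card_coe, pow_succ, mul_assoc,
      mul_inv_cancel_left₀ hS0]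
    simp only [Equiv.coe_mulRight]
    rw [Finset.sum_coe_sort S (fun s => (cayleyOp S ^ n) (unitMass (1 : G)) (x * s)),
      Finset.mul_sum]
    exact Finset.sum_congr rfl fun s _ => ih _

open scoped RealInnerProductSpace in
theorem walkCount_two_mul (S : Finset G) (hS : S.Nonempty) (hsymm : ∀ s ∈ S, s⁻¹ ∈ S) (n : ℕ) :
    walkCount S (2 * n) 1 =
      (S.card : ℝ) ^ (2 * n) * ‖(cayleyOp S ^ n) (unitMass (1 : G))‖ ^ 2 := by
  have e : (cayleyOp S ^ (2 * n)) (unitMass (1 : G)) =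
      (cayleyOp S ^ n) ((cayleyOp S ^ n) (unitMass (1 : G))) := by rw [two_mul, pow_add]; rfl
  rw [walkCount_eq S hS, ← real_inner_self_eq_norm_sq, ← inner_cayleyOp_pow S hsymm, ← e,
    inner_unitMass]

/-- Closed walks of even length are counted by squared norms, and one more averaging step multiplies
the norm by at most `ρ(G, S)`. -/
theorem walkCount_two_mul_succ_le (S : Finset G) (hS : S.Nonempty) (hsymm : ∀ s ∈ S, s⁻¹ ∈ S)
    (n : ℕ) : walkCount S (2 * n + 2) 1 ≤
      (S.card : ℝ) ^ 2 * cayleyRho S ^ 2 * walkCount S (2 * n) 1 := by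
  rw [show 2 * n + 2 = 2 * (n + 1) by ring, walkCount_two_mul S hS hsymm,
    walkCount_two_mul S hS hsymm]
  have e : (cayleyOp S ^ (n + 1)) (unitMass (1 : G)) =
      cayleyOp S ((cayleyOp S ^ n) (unitMass (1 : G))) := by rw [pow_succ']; rfl
  have h : ‖(cayleyOp S ^ (n + 1)) (unitMass (1 : G))‖ ≤
      cayleyRho S * ‖(cayleyOp S ^ n) (unitMass (1 : G))‖ := by
    rw [e]; exact (cayleyOp S).le_opNorm _
  calc _ ≤ (S.card : ℝ) ^ (2 * (n + 1)) *
        (cayleyRho S * ‖(cayleyOp S ^ n) (unitMass (1 : G))‖) ^ 2 := by gcongr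
    _ = _ := by ring

/-- Inserting a step `s` followed by `s⁻¹`. -/
theorem walkCount_le_walkCount_succ (S : Finset G) (hsymm : ∀ s ∈ S, s⁻¹ ∈ S) (n : ℕ) (x : G)
    {s : G} (hs : s ∈ S) : walkCount S n x ≤ walkCount S (n + 1) (x * s) := by
  rw [walkCount_succ]
  refine le_trans (le_of_eq ?_) (Finset.single_le_sum
    (f := fun t => walkCount S n (x * s * t)) (fun t _ => walkCount_nonneg S n _) (hsymm s hs))
  simp

end Walks

/-! ### Loop costs and exponentially weighted walks -/

section Loops

variable {G : Type*} [Group G] (H : Subgroup G) (S : Finset G)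

theorem mem_conjInter {g s : G} : s ∈ conjInter H S g ↔ s ∈ S ∧ g * s * g⁻¹ ∈ H := by
  classical
  simp only [conjInter, conjSubgroup, Finset.mem_filter, Subgroup.mem_map, and_congr_right_iff]
  refine fun _ => ⟨?_, fun h => ⟨_, h, ?_⟩⟩
  · rintro ⟨h, hh, rfl⟩
    simpa [mul_assoc] using hh
  · simp [mul_assoc]

theorem conjInter_mul_left {h : G} (hh : h ∈ H) (g : G) :
    conjInter H S (h * g) = conjInter H S g := by
  ext s
  rw [mem_conjInter, mem_conjInter, and_congr_right_iff]
  intro _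
  rw [show h * g * s * (h * g)⁻¹ = h * (g * s * g⁻¹) * h⁻¹ by group,
    H.mul_mem_cancel_right (H.inv_mem hh), H.mul_mem_cancel_left hh]

/-- The exponential cost `-log ρ(⟨H^g ∩ S⟩, H^g ∩ S)` of a loop at `Hg`. -/
def loopCost (g : G) : ℝ := -Real.log (spanRho (conjInter H S g))

theorem loopCost_nonneg (g : G) : 0 ≤ loopCost H S g :=
  neg_nonneg.2 (Real.log_nonpos (spanRho_nonneg _) (spanRho_le_one _))

/-- Only an inequality, because `Real.log 0 = 0` makes the cost `0` when the spectral radius is `0`,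
as it is for an empty intersection. -/
theorem exp_loopCost_mul_le (g : G) :
    Real.exp (loopCost H S g) * spanRho (conjInter H S g) ≤ 1 := by
  rcases (spanRho_nonneg (conjInter H S g)).eq_or_lt with h | h
  · rw [← h]; simp
  · rw [loopCost, Real.exp_neg, Real.exp_log h, inv_mul_cancel₀ h.ne']

open scoped Classical in
/-- The cost of the step from `g` to `gs`, which is zero unless `Hgs = Hg`. -/
def stepCost (g s : G) : ℝ := if s ∈ conjInter H S g then loopCost H S g else 0

theorem stepCost_nonneg (g s : G) : 0 ≤ stepCost H S g s := by
  unfold stepCost; split_ifs; exacts [loopCost_nonneg H S g, le_rfl]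

theorem stepCost_mul_left {h : G} (hh : h ∈ H) (g s : G) :
    stepCost H S (h * g) s = stepCost H S g s := by
  unfold stepCost
  classical
  exact if_congr (by rw [conjInter_mul_left H S hh])
    (by rw [loopCost, conjInter_mul_left H S hh, loopCost]) rfl

/-- The total cost of the loops along the walk with steps `w` started at `x`. -/
def walkCost {n : ℕ} (x : G) (w : Fin n → G) : ℝ :=
  ∑ i : Fin n, stepCost H S (x * Fin.partialProd w i.castSucc) (w i)

theorem walkCost_cons {n : ℕ} (x s : G) (w : Fin n → G) :
    walkCost H S x (Fin.cons s w : Fin (n + 1) → G) =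
      stepCost H S x s + walkCost H S (x * s) w := by
  rw [walkCost, Fin.sum_univ_succ, walkCost]
  simp only [Fin.castSucc_zero, Fin.partialProd_zero, mul_one, Fin.cons_zero, Fin.cons_succ,
    ← Fin.succ_castSucc, partialProd_cons_succ, mul_assoc]

theorem walkCost_nonneg {n : ℕ} (x : G) (w : Fin n → G) : 0 ≤ walkCost H S x w :=
  Finset.sum_nonneg fun _ _ => stepCost_nonneg H S _ _

/-- The loops that can be inserted along a closed walk bound the cost of the loops of the closed
walks that are longer by two. -/
theorem walkSum_sum_le_walkSum_walkCost (hsymm : ∀ s ∈ S, s⁻¹ ∈ S) (m : ℕ) (x : G) :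
    walkSum S m x (fun w => ∑ i, ((conjInter H S (x * Fin.partialProd w i)).card : ℝ) *
        loopCost H S (x * Fin.partialProd w i)) ≤
      walkSum S (m + 2) x (walkCost H S x) := by
  classical
  -- Loops inserted at time `0` are paid for by the first step of the longer walk; the induction
  -- treats later insertions after one step.
  have hfirst (m : ℕ) (x : G) : ((conjInter H S x).card : ℝ) * loopCost H S x * walkCount S m x ≤
      ∑ s ∈ S, stepCost H S x s * walkCount S (m + 1) (x * s) := by
    have hsub : conjInter H S x ⊆ S := fun s hs => ((mem_conjInter H S).1 hs).1
    calc _ = ∑ s ∈ conjInter H S x, loopCost H S x * walkCount S m x := by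
          rw [Finset.sum_const, nsmul_eq_mul, mul_assoc]
      _ ≤ ∑ s ∈ conjInter H S x, stepCost H S x s * walkCount S (m + 1) (x * s) := by
          refine Finset.sum_le_sum fun s hs => ?_
          rw [stepCost, if_pos hs]
          exact mul_le_mul_of_nonneg_left (walkCount_le_walkCount_succ S hsymm m x (hsub hs))
            (loopCost_nonneg H S x)
      _ ≤ _ := Finset.sum_le_sum_of_subset_of_nonneg hsub fun s _ _ =>
          mul_nonneg (stepCost_nonneg H S x s) (walkCount_nonneg S _ _)
  have hsplit (m : ℕ) (x : G) : walkSum S (m + 1) x (walkCost H S x) =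
      ∑ s ∈ S, stepCost H S x s * walkCount S m (x * s) +
        ∑ s ∈ S, walkSum S m (x * s) (walkCost H S (x * s)) := by
    rw [walkSum_succ, ← Finset.sum_add_distrib]
    refine Finset.sum_congr rfl fun s _ => ?_
    simp only [walkCost_cons]
    rw [walkSum_add, walkSum_const]
  induction m generalizing x with
  | zero =>
    rw [hsplit]
    refine le_add_of_le_of_nonneg (le_trans (le_of_eq ?_) (hfirst 0 x))
      (Finset.sum_nonneg fun s _ => walkSum_nonneg S _ _ (walkCost_nonneg H S _))
    rw [walkCount, walkSum_zero, walkSum_zero]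
    split_ifs <;> simp
  | succ m ih =>
    rw [hsplit]
    simp only [Fin.sum_univ_succ (n := m + 1), Fin.partialProd_zero, mul_one]
    rw [walkSum_add, walkSum_const]
    refine add_le_add (hfirst (m + 1) x) ?_
    rw [walkSum_succ]
    refine Finset.sum_le_sum fun s _ => le_trans (le_of_eq ?_) (ih (x * s))
    simp only [partialProd_cons_succ, mul_assoc]

/-- The vector `x ↦ ∑ exp (cost)`, over the walks of length `n` whose steps lead from `x` to the
identity and from `Hg` to `H`. -/
def weightVec : ℕ → G → ell2 G
  | 0, g => open scoped Classical in if g ∈ H then unitMass 1 else 0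
  | n + 1, g => ∑ s ∈ S, Real.exp (stepCost H S g s) •
      permIsometry (Equiv.mulRight s) (weightVec n (g * s))

/-- The position in `G` is the argument of the vector, so the index `g` matters only through `Hg`.
This is why all loops at `g` act on one common vector. -/
theorem weightVec_mul_left {h : G} (hh : h ∈ H) (n : ℕ) (g : G) :
    weightVec H S n (h * g) = weightVec H S n g := by
  induction n generalizing g with
  | zero =>
    simp only [weightVec]
    classical
    exact if_congr (H.mul_mem_cancel_left hh) rfl rfl
  | succ n ih => simp only [weightVec, stepCost_mul_left H S hh, mul_assoc, ih]

theorem weightVec_mul_right {n : ℕ} {g s : G} (hs : s ∈ conjInter H S g) :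
    weightVec H S n (g * s) = weightVec H S n g := by
  rw [← weightVec_mul_left H S ((mem_conjInter H S).1 hs).2 n g]
  simp

/-- On the diagonal the two walks start together, and ending at the identity already forces the
coset to end at `H`. -/
theorem weightVec_apply_self (n : ℕ) (x : G) :
    weightVec H S n x x = walkSum S n x fun w => Real.exp (walkCost H S x w) := by
  classical
  induction n generalizing x with
  | zero =>
    rw [walkSum_zero, weightVec]
    by_cases hx : x = 1
    · subst hx; simp [unitMass_apply, walkCost]
    · by_cases h : x ∈ H <;> simp [h, hx, unitMass_apply]
  | succ n ih =>
    rw [walkSum_succ, weightVec]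
    simp only [lp.coeFn_sum, Finset.sum_apply, lp.coeFn_smul, Pi.smul_apply, permIsometry_apply,
      Equiv.coe_mulRight, ih, walkCost_cons, Real.exp_add, walkSum_mul_left, smul_eq_mul]

/-- The averaging operator of the Schreier graph. -/
abbrev schreierOp : ell2 (Cosets H) →L[ℝ] ell2 (Cosets H) :=
  markovOp fun s : S => cosetPerm H (s : G)

/-- The number of walks of length `n` from `Hg` to `H` in the Schreier graph. -/
def schreierCount (n : ℕ) (g : G) : ℝ :=
  (S.card : ℝ) ^ n * (schreierOp H S ^ n) (unitMass (Quotient.mk _ 1)) (Quotient.mk _ g)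

theorem schreierCount_succ (hS : S.Nonempty) (n : ℕ) (g : G) :
    schreierCount H S (n + 1) g = ∑ s ∈ S, schreierCount H S n (g * s) := by
  have hS0 : (S.card : ℝ) ≠ 0 := by exact_mod_cast hS.card_pos.ne'
  have e (u : ell2 (Cosets H)) : (schreierOp H S ^ (n + 1)) u =
      schreierOp H S ((schreierOp H S ^ n) u) := by rw [pow_succ']; rfl
  rw [schreierCount, e, markovOp_apply, Fintype.card_coe, pow_succ, mul_assoc,
    mul_inv_cancel_left₀ hS0, Finset.mul_sum]
  exact Finset.sum_coe_sort S (fun s => schreierCount H S n (g * s))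

theorem schreierCount_mul_right {n : ℕ} {g s : G} (hs : s ∈ conjInter H S g) :
    schreierCount H S n (g * s) = schreierCount H S n g := by
  have : (Quotient.mk _ (g * s) : Cosets H) = Quotient.mk _ g := by
    refine Quotient.sound (QuotientGroup.rightRel_apply.2 ?_)
    have := H.inv_mem ((mem_conjInter H S).1 hs).2
    simpa [mul_assoc] using this
  rw [schreierCount, this, schreierCount]

theorem schreierCount_le (n : ℕ) (g : G) :
    schreierCount H S n g ≤ (S.card : ℝ) ^ n * schreierRho H S ^ n := by
  refine mul_le_mul_of_nonneg_left ?_ (by positivity)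
  calc _ ≤ ‖(schreierOp H S ^ n) (unitMass (Quotient.mk _ 1)) (Quotient.mk _ g)‖ := le_abs_self _
    _ ≤ ‖(schreierOp H S ^ n) (unitMass (Quotient.mk _ 1))‖ :=
      lp.norm_apply_le_norm (by norm_num) _ _
    _ ≤ ‖schreierOp H S ^ n‖ * ‖(unitMass (Quotient.mk _ 1) : ell2 (Cosets H))‖ :=
      ContinuousLinearMap.le_opNorm _ _
    _ ≤ schreierRho H S ^ n := by
      rw [norm_unitMass, mul_one]
      rcases n.eq_zero_or_pos with rfl | hn
      · exact ContinuousLinearMap.norm_id_le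
      · exact norm_pow_le' _ hn

/-- Induction on the first step. The loops are estimated together, their weight cancelling the
factor `ρ` of the translation sum; the other steps are isometries of weight `1`, for which the
triangle inequality suffices. -/
theorem norm_weightVec_le (hS : S.Nonempty) (n : ℕ) (g : G) :
    ‖weightVec H S n g‖ ≤ schreierCount H S n g := by
  classical
  induction n generalizing g with
  | zero =>
    have : (Quotient.mk _ g : Cosets H) = Quotient.mk _ 1 ↔ g ∈ H := by
      rw [Quotient.eq]
      simp [QuotientGroup.rightRel_apply]
    by_cases h : g ∈ H <;> simp [weightVec, schreierCount, unitMass_apply, this, h, norm_unitMass]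
  | succ n ih =>
    have hF : S.filter (· ∈ conjInter H S g) = conjInter H S g := by
      ext s
      simp only [Finset.mem_filter, and_iff_right_iff_imp]
      exact fun hs => ((mem_conjInter H S).1 hs).1
    rw [schreierCount_succ H S hS, weightVec,
      ← Finset.sum_filter_add_sum_filter_not S (· ∈ conjInter H S g), hF,
      ← Finset.sum_filter_add_sum_filter_not S (· ∈ conjInter H S g)
        (fun s => schreierCount H S n (g * s)), hF]
    refine (norm_add_le _ _).trans (add_le_add ?_ (norm_sum_le_of_le _ fun s hs => ?_))
    · have h1 : ∑ s ∈ conjInter H S g, Real.exp (stepCost H S g s) •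
          permIsometry (Equiv.mulRight s) (weightVec H S n (g * s)) =
          Real.exp (loopCost H S g) • ∑ s ∈ conjInter H S g,
            permIsometry (Equiv.mulRight s) (weightVec H S n g) := by
        rw [Finset.smul_sum]
        refine Finset.sum_congr rfl fun s hs => ?_
        rw [weightVec_mul_right H S hs, stepCost, if_pos hs]
      have h2 : ∑ s ∈ conjInter H S g, schreierCount H S n (g * s) =
          (conjInter H S g).card * schreierCount H S n g := by
        rw [Finset.sum_congr rfl fun s hs => schreierCount_mul_right H S hs, Finset.sum_const,
          nsmul_eq_mul]
      rw [h1, h2, norm_smul, Real.norm_eq_abs, Real.abs_exp]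
      calc _ ≤ Real.exp (loopCost H S g) * ((conjInter H S g).card * spanRho (conjInter H S g) *
            ‖weightVec H S n g‖) := by
            gcongr
            exact norm_sum_translate_le _ _
        _ = (conjInter H S g).card * ‖weightVec H S n g‖ *
            (Real.exp (loopCost H S g) * spanRho (conjInter H S g)) := by ring
        _ ≤ (conjInter H S g).card * ‖weightVec H S n g‖ * 1 := by
            gcongr
            exact exp_loopCost_mul_le H S g
        _ ≤ _ := by
            rw [mul_one]
            gcongr
            exact ih g
    · rw [stepCost, if_neg (Finset.mem_filter.1 hs).2, Real.exp_zero, one_smul,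
        LinearIsometry.norm_map]
      exact ih _

theorem sum_exp_walkCost_le (hS : S.Nonempty) (n : ℕ) :
    ∑ w ∈ closedWalks S n, Real.exp (walkCost H S 1 w) ≤
      (S.card : ℝ) ^ n * schreierRho H S ^ n := by
  rw [← walkSum_one_eq, ← weightVec_apply_self]
  calc _ ≤ ‖weightVec H S n 1 1‖ := le_abs_self _
    _ ≤ ‖weightVec H S n 1‖ := lp.norm_apply_le_norm (by norm_num) _ _
    _ ≤ _ := (norm_weightVec_le H S hS n 1).trans (schreierCount_le H S n 1)

end Loops

/-! ### Averaging over closed walks and passing to the limit -/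

theorem integral_occMeasure {G : Type*} [Group G] (S : Finset G) (n : ℕ) (k : G → ℝ) :
    ∫ g, k g ∂(occMeasure S n) = ((closedWalks S n).card : ℝ)⁻¹ * ∑ w ∈ closedWalks S n,
      (n : ℝ)⁻¹ * ∑ i : Fin n, k (Fin.partialProd w i.succ) := by
  let _ : MeasurableSpace G := ⊤
  have hd (x : G) : Integrable k (Measure.dirac x) := integrable_dirac (by simp)
  rcases n.eq_zero_or_pos with rfl | hn
  · simp [occMeasure]
  have hn' : ((n : ℝ≥0∞)⁻¹) ≠ ∞ := by simp [hn.ne']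
  have hs (w : Fin n → G) : Integrable k
      (∑ i : Fin n, Measure.dirac (Fin.partialProd w i.succ)) :=
    integrable_finsetSum_measure.2 fun i _ => hd _
  unfold occMeasure
  rw [integral_smul_measure, integral_finsetSum_measure fun w _ => (hs w).smul_measure hn']
  simp only [integral_smul_measure, integral_finsetSum_measure fun i _ => hd _, integral_dirac,
    ENNReal.toReal_inv, ENNReal.toReal_natCast, smul_eq_mul]

/-- Jensen's inequality for a uniform average. -/
theorem card_mul_exp_average_le {ι : Type*} (A : Finset ι) (hA : A.Nonempty) (X : ι → ℝ) :
    (A.card : ℝ) * Real.exp ((A.card : ℝ)⁻¹ * ∑ w ∈ A, X w) ≤ ∑ w ∈ A, Real.exp (X w) := by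
  have hc : (0 : ℝ) < A.card := by exact_mod_cast hA.card_pos
  have h := convexOn_exp.map_sum_le (t := A) (w := fun _ => (A.card : ℝ)⁻¹) (p := X)
    (fun _ _ => by positivity) (by simp [hc.ne']) (fun _ _ => Set.mem_univ _)
  simp only [smul_eq_mul, ← Finset.mul_sum] at h
  calc _ ≤ (A.card : ℝ) * ((A.card : ℝ)⁻¹ * ∑ w ∈ A, Real.exp (X w)) := by gcongr
    _ = _ := mul_inv_cancel_left₀ hc.ne' _

variable {G : Type*} [Group G] (H : Subgroup G) (S : Finset G)

/-- The mean loop cost with respect to the occupation measure. -/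
def meanCost (n : ℕ) : ℝ :=
  ∫ g, ((conjInter H S g).card : ℝ) * -Real.log (spanRho (conjInter H S g)) ∂(occMeasure S n)

theorem meanCost_nonneg (n : ℕ) : 0 ≤ meanCost H S n :=
  integral_nonneg fun g => mul_nonneg (Nat.cast_nonneg _) (loopCost_nonneg H S g)

theorem mul_meanCost_le (hsymm : ∀ s ∈ S, s⁻¹ ∈ S) (m : ℕ) (hm : 0 < (closedWalks S m).card) :
    (closedWalks S m).card * (m * meanCost H S m) ≤
      ∑ w ∈ closedWalks S (m + 2), walkCost H S 1 w := by
  have h := walkSum_sum_le_walkSum_walkCost H S hsymm m 1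
  rw [walkSum_one_eq, walkSum_one_eq] at h
  refine le_trans ?_ h
  rw [meanCost, integral_occMeasure]
  have hm' : ((closedWalks S m).card : ℝ) ≠ 0 := by exact_mod_cast hm.ne'
  rw [mul_left_comm, mul_inv_cancel_left₀ hm', Finset.mul_sum]
  refine Finset.sum_le_sum fun w _ => ?_
  simp only [one_mul]
  have hk (i : Fin (m + 1)) : 0 ≤ ((conjInter H S (Fin.partialProd w i)).card : ℝ) *
      loopCost H S (Fin.partialProd w i) := mul_nonneg (Nat.cast_nonneg _) (loopCost_nonneg H S _)
  rcases m.eq_zero_or_pos with rfl | hm0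
  · simpa using hk 0
  -- Insertions are possible at times `0, …, m`, but the occupation measure omits time `0`; that
  -- nonnegative term is dropped.
  rw [mul_inv_cancel_left₀ (by exact_mod_cast hm0.ne'), Fin.sum_univ_succ]
  exact le_add_of_nonneg_left (hk 0)

theorem exp_mul_meanCost_le (hS : S.Nonempty) (hsymm : ∀ s ∈ S, s⁻¹ ∈ S) (n : ℕ)
    (hn : 0 < walkCount S (2 * n) 1) (hn' : 0 < walkCount S (2 * n + 2) 1) :
    walkCount S (2 * n + 2) 1 * Real.exp ((2 * n : ℕ) *
        (meanCost H S (2 * n) / ((S.card : ℝ) ^ 2 * cayleyRho S ^ 2))) ≤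
      (S.card : ℝ) ^ (2 * n + 2) * schreierRho H S ^ (2 * n + 2) := by
  refine le_trans ?_ (sum_exp_walkCost_le H S hS (2 * n + 2))
  have hratio := walkCount_two_mul_succ_le S hS hsymm n
  rw [walkCount_one_eq] at hn hn' ⊢
  rw [walkCount_one_eq, walkCount_one_eq] at hratio
  have hne : (closedWalks S (2 * n + 2)).Nonempty := Finset.card_pos.1 (by exact_mod_cast hn')
  refine le_trans ?_ (card_mul_exp_average_le _ hne _)
  refine mul_le_mul_of_nonneg_left (Real.exp_le_exp.2 ?_) hn'.le
  have hcost := mul_meanCost_le H S hsymm (2 * n) (by exact_mod_cast hn)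
  have hD : 0 < (S.card : ℝ) ^ 2 * cayleyRho S ^ 2 := pos_of_mul_pos_left (hn'.trans_le hratio) hn.le
  rw [inv_mul_eq_div, le_div_iff₀ hn', ← mul_div_assoc, div_mul_eq_mul_div, div_le_iff₀ hD]
  have hJ : 0 ≤ ((2 * n : ℕ) : ℝ) * meanCost H S (2 * n) :=
    mul_nonneg (Nat.cast_nonneg _) (meanCost_nonneg H S _)
  calc _ ≤ ((2 * n : ℕ) : ℝ) * meanCost H S (2 * n) *
        ((S.card : ℝ) ^ 2 * cayleyRho S ^ 2 * (closedWalks S (2 * n)).card) := by gcongr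
    _ = (closedWalks S (2 * n)).card * ((2 * n : ℕ) * meanCost H S (2 * n)) *
        ((S.card : ℝ) ^ 2 * cayleyRho S ^ 2) := by ring
    _ ≤ _ := by gcongr

theorem cayleyRho_pos (hS : S.Nonempty) : 0 < cayleyRho S := by
  refine norm_pos_iff.2 fun h => ?_
  obtain ⟨s, hs⟩ := hS
  have h1 : cayleyOp S (unitMass (1 : G)) s⁻¹ = 0 :=
    congrArg (fun T : ell2 G →L[ℝ] ell2 G => T (unitMass 1) s⁻¹) h
  have hc : (0 : ℝ) < Fintype.card S := by
    rw [Fintype.card_coe]; exact_mod_cast Finset.card_pos.2 ⟨s, hs⟩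
  rw [markovOp_apply, mul_eq_zero, or_iff_right (inv_ne_zero hc.ne')] at h1
  classical
  have h2 := (Finset.sum_eq_zero_iff_of_nonneg (fun i _ => by
    rw [unitMass_apply]; split_ifs <;> simp)).1 h1 ⟨s, hs⟩ (Finset.mem_univ _)
  simp [unitMass_apply] at h2

/-- The bound on the mean loop cost at a fixed time and below the spectral radius. -/
theorem exists_mul_meanCost_le (hS : S.Nonempty) (hsymm : ∀ s ∈ S, s⁻¹ ∈ S) {a : ℝ} (ha : 0 < a)
    (haS : a < cayleyRho S) : 0 < schreierRho H S ∧ ∃ C : ℝ, ∀ n : ℕ,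
      (2 * n : ℝ) * (meanCost H S (2 * n) / ((S.card : ℝ) ^ 2 * cayleyRho S ^ 2)) ≤
        (2 * n + 2) * (Real.log (schreierRho H S) - Real.log a) + C := by
  obtain ⟨c, hc, hlow⟩ := exists_le_norm_cayleyOp_pow S hsymm ha haS
  have hS0 : (0 : ℝ) < S.card := by exact_mod_cast hS.card_pos
  have hcount (n : ℕ) : (S.card : ℝ) ^ (2 * n) * (c * a ^ n) ^ 2 ≤ walkCount S (2 * n) 1 := by
    rw [walkCount_two_mul S hS hsymm]
    gcongr
    exact hlow n
  have hpos (n : ℕ) : 0 < walkCount S (2 * n) 1 := lt_of_lt_of_le (by positivity) (hcount n)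
  have hmain (n : ℕ) := exp_mul_meanCost_le H S hS hsymm n (hpos n) (hpos (n + 1))
  -- If it vanished, the right side of `hmain 0` would be zero and the left side positive.
  have hrho : 0 < schreierRho H S := by
    refine (graphRho_nonneg _).lt_of_ne fun h => ?_
    have h0 := (mul_pos (hpos (0 + 1)) (Real.exp_pos _)).trans_le (hmain 0)
    rw [schreierRho, ← h] at h0
    simp at h0
  refine ⟨hrho, -Real.log (c ^ 2), fun n => ?_⟩
  set J := meanCost H S (2 * n) / ((S.card : ℝ) ^ 2 * cayleyRho S ^ 2)
  have h1 : c ^ 2 * a ^ (2 * n + 2) * Real.exp ((2 * n : ℕ) * J) ≤ schreierRho H S ^ (2 * n + 2) := by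
    refine le_of_mul_le_mul_left ?_ (pow_pos hS0 (2 * n + 2))
    refine le_trans ?_ (hmain n)
    rw [← mul_assoc]
    gcongr
    refine le_trans (le_of_eq ?_) (hcount (n + 1))
    ring
  have h2 := Real.log_le_log (by positivity) h1
  rw [Real.log_mul (by positivity) (by positivity), Real.log_mul (by positivity) (by positivity),
    Real.log_exp, Real.log_pow a, Real.log_pow (schreierRho H S)] at h2
  push_cast at h2
  linarith

theorem kestenI_div_le (hS : S.Nonempty) (hsymm : ∀ s ∈ S, s⁻¹ ∈ S) {a : ℝ} (ha : 0 < a)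
    (haS : a < cayleyRho S) : kestenI H S / ((S.card : ℝ) ^ 2 * cayleyRho S ^ 2) ≤
      Real.log (schreierRho H S) - Real.log a := by
  obtain ⟨-, C, hC⟩ := exists_mul_meanCost_le H S hS hsymm ha haS
  have hS0 : (0 : ℝ) < S.card := by exact_mod_cast hS.card_pos
  have hrho := cayleyRho_pos S hS
  set D := (S.card : ℝ) ^ 2 * cayleyRho S ^ 2 with hD
  have hD0 : 0 < D := by positivity
  set L := Real.log (schreierRho H S) - Real.log a
  rw [div_le_iff₀ hD0]
  -- The bound rewrites as `(2n + 2) L + C = 2n (L + (2L + C)/(2n))`.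
  have htend : Tendsto (fun n : ℕ => (L + (2 * L + C) / (2 * n)) * D) atTop (nhds (L * D)) := by
    have : Tendsto (fun n : ℕ => (2 * L + C) / (2 * (n : ℝ))) atTop (nhds 0) :=
      tendsto_const_nhds.div_atTop (tendsto_natCast_atTop_atTop.const_mul_atTop two_pos)
    simpa using (this.const_add L).mul_const D
  have hle : ∀ᶠ n : ℕ in atTop, meanCost H S (2 * n) ≤ (L + (2 * L + C) / (2 * n)) * D := by
    filter_upwards [eventually_gt_atTop 0] with n hn
    have hn0 : (0 : ℝ) < 2 * n := by positivity
    rw [← div_le_iff₀ hD0]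
    refine le_of_mul_le_mul_left ((hC n).trans (le_of_eq ?_)) hn0
    field_simp
    ring
  rw [← htend.limsup_eq]
  -- A real `limsup` is monotone only under boundedness conditions: the lower one comes from
  -- nonnegative costs, the upper one from the convergent majorant.
  exact limsup_le_limsup hle
    (isCoboundedUnder_le_of_le atTop (x := 0) fun n => meanCost_nonneg H S _)
    htend.isBoundedUnder_le

end Kesten

end

theorem theoremt {G : Type*} [Group G] (S : Finset G) (hsymm : ∀ s ∈ S, s⁻¹ ∈ S)
    (hgen : Subgroup.closure (S : Set G) = ⊤) (H : Subgroup G) :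
    Real.log (Kesten.schreierRho H S) - Real.log (Kesten.cayleyRho S) ≥
      Kesten.kestenI H S / ((S.card : ℝ) ^ 2 * Kesten.cayleyRho S ^ 2) := by
  rcases S.eq_empty_or_nonempty with rfl | hS
  -- For empty `S` both radii are `0`, and the conventions for `log 0` and division by `0` make both
  -- sides `0`.
  · simp [Kesten.schreierRho, Kesten.cayleyRho, Kesten.graphRho_of_isEmpty]
  have hrho := Kesten.cayleyRho_pos S hS
  have hlim : Tendsto (fun a => Real.log (Kesten.schreierRho H S) - Real.log a)
      (nhdsWithin (Kesten.cayleyRho S) (Set.Iio (Kesten.cayleyRho S)))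
      (nhds (Real.log (Kesten.schreierRho H S) - Real.log (Kesten.cayleyRho S))) :=
    ((Real.continuousAt_log hrho.ne').tendsto.const_sub _).mono_left nhdsWithin_le_nhds
  refine ge_of_tendsto hlim ?_
  filter_upwards [Ioo_mem_nhdsLT hrho] with a ha
  exact Kesten.kestenI_div_le H S hS hsymm ha.1 ha.2
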